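/- **Theorem 1 (The large deviations of guesswork).** Let $\mathbb{A}=\{1,\dots,m\}$ be a finite alphabet and, for each $k$, let $W_k$ be a random word with values in $\mathbb{A}^k$. List the words of $\mathbb{A}^k$ in decreasing order of the probability $P(W_k=w)$ (ties broken arbitrarily), and let $G(w)\in\{1,\dots,m^k\}$, the guesswork of $w$, be the position of $w$ in this list. Let $$R_k(s)=\frac{1}{1-s}\log\sum_{w\in\mathbb{A}^k}P(W_k=w)^s\qquad(s>0,\ s\neq 1)$$ be the Rényi entropy of $W_k$ and let $$\Lambda(\alpha)=\lim_{k\to\infty}\frac1k\log E\big[G(W_k)^\alpha\big]$$ wherever this limit exists. Assume: 1. for every $\alpha>-1$ the limit $\Lambda(\alpha)$ exists and is finite; for every $\alpha>-1$, $\alpha\ne0$, the limit $\lim_{k}k^{-1}R_k\big(\tfrac1{1+\alpha}\big)$ exists, is finite, and $\Lambda(\alpha)=\alpha\lim_{k}k^{-1}R_k\big(\tfrac1{1+\alpha}\big)$; and $\Lambda$ is continuously differentiable on $(-1,\infty)$; 2. the limit $p_1=\lim_{k\to\infty}k^{-1}\log P(G(W_k)=1)$ exists and is finite. Then the limit $\Lambda(\alpha)$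 exists and is finite for every $\alpha\in\mathbb{R}$, and the sequence $\{k^{-1}\log G(W_k)\}$ satisfies a large deviation principle on $\mathbb{R}$ with speed $k$ and rate function the Legendre–Fenchel transform $\Lambda^*(x)=\sup_{\alpha\in\mathbb{R}}\{x\alpha-\Lambda(\alpha)\}$; that is, $\Lambda^*:\mathbb{R}\to[0,\infty]$ is lower semicontinuous and, for every closed $F\subseteq\mathbb{R}$ and every open $U\subseteq\mathbb{R}$, $$\limsup_{k\to\infty}\frac1k\log P\Big(\frac1k\log G(W_k)\in F\Big)\le-\inf_{x\in F}\Lambda^*(x),\qquad \liminf_{k\to\infty}\frac1k\log P\Big(\frac1k\log G(W_k)\in U\Big)\ge-\inf_{x\in U}\Lambda^*(x).$$ Moreover, $\Lambda^*$ is continuous on the set where it is finite, the limit $\gamma=\lim_{\alpha\downarrow-1}\Lambda'(\alpha)$ exists and lies in $[0,\log m]$, $\Lambda^*(x)=-x-p_1$ for all $x\in[0,\gamma]$, and $\Lambda^*$ is strictly convex on $\{x\ge\gamma:\Lambda^*(x)<\infty\}$. -/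

import Mathlib

open Set Filter Topology MeasureTheory ProbabilityTheory

namespace Guesswork

noncomputable section

/-- `g` is a guesswork function for the probability mass function `p` on the finite set `X`:
`g w` is the position of `w` in a listing of all elements of `X` in decreasing order of
probability (ties are broken in an arbitrary way). -/
structure IsGuesswork {X : Type*} [Fintype X] (p : X → ℝ) (g : X → ℕ) : Prop where
  bijOn : Set.BijOn g Set.univ (Set.Icc 1 (Fintype.card X))
  lt_of_prob_lt : ∀ v w : X, p w < p v → g v < g w

/-- The Rényi entropy of order `s` of a probability mass function `p` on a finite set
(with the usual convention that order `1` is the Shannon entropy). -/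
def renyiEntropy {X : Type*} [Fintype X] (p : X → ℝ) (s : ℝ) : ℝ :=
  if s = 1 then ∑ x, Real.negMulLog (p x) else (1 / (1 - s)) * Real.log (∑ x, p x ^ s)

/-- The large deviation principle, with speed `k`, for a sequence of random variables `Y k`,
the `k`-th one defined on the probability space `(Ω k, P k)`, with rate function `I`. -/
structure SatisfiesLDP {E : Type*} [TopologicalSpace E] {Ω : ℕ → Type*}
    [∀ k, MeasurableSpace (Ω k)] (P : ∀ k, Measure (Ω k)) (Y : ∀ k, Ω k → E)
    (I : E → EReal) : Prop where
  nonneg : ∀ x, 0 ≤ I x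
  lowerSemicontinuous : LowerSemicontinuous I
  upper_bound : ∀ F : Set E, IsClosed F →
    limsup (fun k : ℕ => ENNReal.log (P k {ω | Y k ω ∈ F}) / (k : EReal)) atTop
      ≤ - ⨅ x ∈ F, I x
  lower_bound : ∀ U : Set E, IsOpen U →
    - ⨅ x ∈ U, I x
      ≤ liminf (fun k : ℕ => ENNReal.log (P k {ω | Y k ω ∈ U}) / (k : EReal)) atTop

/-- The Legendre–Fenchel transform of `f : ℝ → ℝ`, with values in the extended reals. -/
def legendreFenchel (f : ℝ → ℝ) (x : ℝ) : EReal :=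
  ⨆ α : ℝ, ((x * α - f α : ℝ) : EReal)

section Words

variable {m : ℕ} {Ω : ℕ → Type*} [∀ k, MeasurableSpace (Ω k)]

/-- The law of the random word `W k`, as the function `w ↦ P(W k = w)`. -/
def wordProb (P : ∀ k, Measure (Ω k)) (W : ∀ k, Ω k → (Fin k → Fin m)) (k : ℕ)
    (w : Fin k → Fin m) : ℝ :=
  (P k).real {ω | W k ω = w}

/-- `k⁻¹ log E[exp (α log G(W_k))]`, that is, `k⁻¹ log E[G(W_k) ^ α]`. -/
def scaledCgf (P : ∀ k, Measure (Ω k)) (W : ∀ k, Ω k → (Fin k → Fin m))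
    (G : ∀ k, (Fin k → Fin m) → ℕ) (α : ℝ) (k : ℕ) : ℝ :=
  (k : ℝ)⁻¹ * cgf (fun ω => Real.log (G k (W k ω))) (P k) α

/-- The scaled cumulant generating function `Λ(α) = lim k⁻¹ log E[G(W_k) ^ α]`; it is meaningful
at those `α` at which the limit exists. -/
def sCGF (P : ∀ k, Measure (Ω k)) (W : ∀ k, Ω k → (Fin k → Fin m))
    (G : ∀ k, (Fin k → Fin m) → ℕ) (α : ℝ) : ℝ :=
  limUnder atTop (scaledCgf P W G α)

/-- For `α > -1` the scaled cumulant generating function exists (as a finite limit), equals `α`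
times the specific Rényi entropy of order `1 / (1 + α)`, and is continuously differentiable.
At `α = 0` the middle claim reads `Λ(0) = 0`, which always holds, so nothing is required there. -/
structure RegularSCGF (P : ∀ k, Measure (Ω k)) (W : ∀ k, Ω k → (Fin k → Fin m))
    (G : ∀ k, (Fin k → Fin m) → ℕ) : Prop where
  tendsto : ∀ α : ℝ, -1 < α → Tendsto (scaledCgf P W G α) atTop (𝓝 (sCGF P W G α))
  eq_renyi : ∀ α : ℝ, -1 < α → α ≠ 0 → ∃ r : ℝ,
    Tendsto (fun k : ℕ => (k : ℝ)⁻¹ * renyiEntropy (wordProb P W k) (1 / (1 + α))) atTop (𝓝 r) ∧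
      sCGF P W G α = α * r
  contDiffOn : ContDiffOn ℝ 1 (sCGF P W G) (Set.Ioi (-1))

end Words

end

end Guesswork

/-!
# Large deviations of guesswork

Write `L k = log G(W k)`, which takes values in `[0, k log m]`, and `Y k = L k / k`.

*Existence of the limit.* The probabilities decrease along the list, so for `α ≤ -1` the moment
`E[G ^ α]` lies between `P(G = 1)` and `P(G = 1) (1 + k log m)`, by the harmonic sum
(`IsGuesswork.mgf_le`). Hence `Λ = p₁` on `(-∞, -1]`. Thus `Λ` is a finite convex nondecreasing
function on the line, differentiable except perhaps at `-1`, where its right derivative is `γ`.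

*Upper bound.* This is Chernoff's bound and compactness (`limsup_log_measure_le`), for any
nonnegative variables bounded by a multiple of `k`.

*Lower bound.* It suffices to bound `P(|Y k - x| < ε)` from below for each `x` in the effective
domain (`HasLocalLowerBound`, `satisfiesLDP_of_hasLocalLowerBound`). At a slope `x = Λ'(α)` this
is the usual tilting argument (`hasLocalLowerBound_of_hasDerivAt`); beyond `γ` only the supremum
of the slopes remains, and it is a limit of slopes. The points of `(0, γ)` are not slopes when
`Λ` has a corner at `-1`, and here the structure of guesswork enters: an average word among those
of rank about `exp (k y)`, with `y` a slope close to `γ`, has a probability of order `exp (k p₁)`,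
so all the words of smaller rank are at least as likely, and there are about `exp (k x)` of them
near rank `exp (k x)` (`HasLocalLowerBound.of_lt`). This gives the rate `-x - p₁`.

*Shape of the rate function.* On `[0, γ]` the supremum in the transform is attained at `-1`. An
interior point of the domain to the right of `γ` is a slope `Λ'(c)`, by the intermediate value
theorem, and the line `x ↦ x c - Λ(c)` touches the transform only there, because `Λ` is
differentiable at `c`; this is strict convexity (`strictConvexOn_legendreFenchel`). Continuity on
the effective domain holds for every transform on the line: lower semicontinuity is automatic,
and convexity gives upper semicontinuity along segments (`continuousOn_legendreFenchel`).
-/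

namespace Guesswork


/-! ### The Legendre–Fenchel transform on the real line -/

section LegendreFenchel

variable {f : ℝ → ℝ} {x y z α : ℝ}

theorem le_legendreFenchel (f : ℝ → ℝ) (x α : ℝ) :
    ((x * α - f α : ℝ) : EReal) ≤ legendreFenchel f x :=
  le_iSup (fun α : ℝ => ((x * α - f α : ℝ) : EReal)) α

theorem legendreFenchel_le_coe_iff {r : ℝ} :
    legendreFenchel f x ≤ r ↔ ∀ α, x * α - f α ≤ r := by
  simp only [legendreFenchel, iSup_le_iff, EReal.coe_le_coe_iff]

theorem legendreFenchel_ne_bot (f : ℝ → ℝ) (x : ℝ) : legendreFenchel f x ≠ ⊥ :=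
  fun h => by simpa [h] using le_legendreFenchel f x 0

theorem coe_toReal_legendreFenchel (h : legendreFenchel f x ≠ ⊤) :
    ((legendreFenchel f x).toReal : EReal) = legendreFenchel f x :=
  EReal.coe_toReal h (legendreFenchel_ne_bot f x)

theorem mul_sub_le_toReal_legendreFenchel (h : legendreFenchel f x ≠ ⊤) (α : ℝ) :
    x * α - f α ≤ (legendreFenchel f x).toReal :=
  legendreFenchel_le_coe_iff.1 (coe_toReal_legendreFenchel h).ge α

theorem legendreFenchel_nonneg (h : f 0 ≤ 0) (x : ℝ) : 0 ≤ legendreFenchel f x := by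
  refine le_trans ?_ (le_legendreFenchel f x 0)
  exact_mod_cast (by linarith : 0 ≤ x * 0 - f 0)

theorem lowerSemicontinuous_legendreFenchel (f : ℝ → ℝ) :
    LowerSemicontinuous (legendreFenchel f) :=
  lowerSemicontinuous_iSup fun α =>
    (continuous_coe_real_ereal.comp (by fun_prop : Continuous fun x : ℝ => x * α - f α))
      |>.lowerSemicontinuous

theorem legendreFenchel_eq_of_support (h : ∀ β, f α + x * (β - α) ≤ f β) :
    legendreFenchel f x = ((x * α - f α : ℝ) : EReal) :=
  le_antisymm (legendreFenchel_le_coe_iff.2 fun β => by linarith [h β])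
    (le_legendreFenchel f x α)

theorem legendreFenchel_eq_top_of_unbounded (h : ∀ r, ∃ α, r < x * α - f α) :
    legendreFenchel f x = ⊤ := by
  refine (EReal.eq_top_iff_forall_lt _).2 fun r => ?_
  obtain ⟨α, hα⟩ := h r
  exact (EReal.coe_lt_coe hα).trans_le (le_legendreFenchel f x α)

/-- The supremum defining the transform at `x` is not attained at a point where the derivative
of `f` differs from `x`. -/
theorem lt_legendreFenchel_of_hasDerivAt (hf : HasDerivAt f y α) (hxy : x ≠ y) :
    ((x * α - f α : ℝ) : EReal) < legendreFenchel f x := by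
  refine lt_of_le_of_ne (le_legendreFenchel f x α) fun h => hxy ?_
  have hmax : IsLocalMax (fun β => x * β - f β) α :=
    Eventually.of_forall fun β => legendreFenchel_le_coe_iff.1 h.ge β
  have hd : HasDerivAt (fun β => x * β - f β) (x - y) α := by
    have := ((hasDerivAt_id' α).const_mul x).fun_sub hf
    rwa [mul_one] at this
  linarith [hmax.hasDerivAt_eq_zero hd]

theorem legendreFenchel_convex_le {a b : ℝ} (hx : legendreFenchel f x ≠ ⊤)
    (hy : legendreFenchel f y ≠ ⊤) (ha : 0 ≤ a) (hb : 0 ≤ b) (hab : a + b = 1) :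
    legendreFenchel f (a * x + b * y) ≤
      ((a * (legendreFenchel f x).toReal + b * (legendreFenchel f y).toReal : ℝ) : EReal) := by
  refine legendreFenchel_le_coe_iff.2 fun α => ?_
  have h1 := mul_le_mul_of_nonneg_left (mul_sub_le_toReal_legendreFenchel hx α) ha
  have h2 := mul_le_mul_of_nonneg_left (mul_sub_le_toReal_legendreFenchel hy α) hb
  have h3 : f α = a * f α + b * f α := by rw [← add_mul, hab, one_mul]
  linarith

theorem convex_setOf_legendreFenchel_ne_top (f : ℝ → ℝ) :
    Convex ℝ {x | legendreFenchel f x ≠ ⊤} := by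
  intro x hx y hy a b ha hb hab
  exact ne_top_of_le_ne_top (EReal.coe_ne_top _) (legendreFenchel_convex_le hx hy ha hb hab)

/-- On a segment that starts at `x`, convexity bounds the transform by an affine function which
agrees with it at `x`. -/
theorem eventually_legendreFenchel_lt_of_segment {c : EReal} (hx : legendreFenchel f x < c)
    (hz : legendreFenchel f z ≠ ⊤) (hxz : x ≠ z) :
    ∀ᶠ y in 𝓝 x, y ∈ segment ℝ x z → legendreFenchel f y < c := by
  have hx' : legendreFenchel f x ≠ ⊤ := hx.ne_top
  have hzx : z - x ≠ 0 := sub_ne_zero.2 hxz.symm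
  let l : ℝ → ℝ := fun y => (1 - (y - x) / (z - x)) * (legendreFenchel f x).toReal +
    (y - x) / (z - x) * (legendreFenchel f z).toReal
  have hl : Tendsto (fun y => (l y : EReal)) (𝓝 x) (𝓝 (legendreFenchel f x)) := by
    have hcont : Continuous fun y => (l y : EReal) :=
      continuous_coe_real_ereal.comp (by fun_prop)
    have := hcont.tendsto x
    simpa [l, coe_toReal_legendreFenchel hx'] using this
  filter_upwards [hl.eventually_lt_const hx] with y hy hyseg
  obtain ⟨a, b, ha, hb, hab, rfl⟩ := hyseg
  refine lt_of_le_of_lt (legendreFenchel_convex_le hx' hz ha hb hab) (lt_of_eq_of_lt ?_ hy)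
  have hb' : (a * x + b * z - x) / (z - x) = b := by
    rw [div_eq_iff hzx]
    linear_combination x * hab
  have ha' : 1 - b = a := by linarith
  simp only [l, smul_eq_mul, hb', ha']

/-- The transform is lower semicontinuous everywhere, and on the line convexity makes it upper
semicontinuous relative to the set where it is finite, end points included. -/
theorem continuousOn_legendreFenchel (f : ℝ → ℝ) :
    ContinuousOn (legendreFenchel f) {x | legendreFenchel f x ≠ ⊤} := by
  intro x hx
  refine tendsto_order.2 ⟨fun c hc => ?_, fun c hc => ?_⟩
  · exact nhdsWithin_le_nhds (lowerSemicontinuous_legendreFenchel f x c hc)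
  have hside : ∀ s ⊆ {x | legendreFenchel f x ≠ ⊤},
      (∀ z ∈ s, z ≠ x → ∀ᶠ y in 𝓝 x, y ∈ s → y ∈ segment ℝ x z) →
      ∀ᶠ y in 𝓝 x, y ∈ s → legendreFenchel f y < c := by
    intro s hs hseg
    by_cases hne : ∃ z ∈ s, z ≠ x
    · obtain ⟨z, hzs, hzx⟩ := hne
      filter_upwards [hseg z hzs hzx,
        eventually_legendreFenchel_lt_of_segment hc (hs hzs) hzx.symm] with y h1 h2 hy
      exact h2 (h1 hy)
    · push Not at hne
      exact Eventually.of_forall fun y hy => by rw [hne y hy]; exact hc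
  have hright := hside ({x | legendreFenchel f x ≠ ⊤} ∩ Ici x) inter_subset_left
    fun z hz hzx => by
      have hlt : x < z := lt_of_le_of_ne hz.2 hzx.symm
      filter_upwards [eventually_lt_nhds hlt] with y hyz hy
      rw [segment_eq_Icc hlt.le]
      exact ⟨hy.2, hyz.le⟩
  have hleft := hside ({x | legendreFenchel f x ≠ ⊤} ∩ Iic x) inter_subset_left
    fun z hz hzx => by
      have hlt : z < x := lt_of_le_of_ne hz.2 hzx
      filter_upwards [eventually_gt_nhds hlt] with y hyz hy
      rw [segment_symm, segment_eq_Icc hlt.le]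
      exact ⟨hyz.le, hy.2⟩
  filter_upwards [nhdsWithin_le_nhds hright, nhdsWithin_le_nhds hleft, self_mem_nhdsWithin]
    with y h1 h2 hy
  exact (le_total x y).elim (fun h => h1 ⟨hy, h⟩) fun h => h2 ⟨hy, h⟩

end LegendreFenchel


/-! ### Probabilities on the exponential scale -/

section ExponentialScale

variable {Ω : Type*} [MeasurableSpace Ω] {μ : Measure Ω} [IsFiniteMeasure μ] {s : Set Ω} {k : ℕ}
  {c : ℝ}

theorem log_measure_div_le (hk : 0 < k) (h : μ.real s ≤ Real.exp (k * c)) :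
    ENNReal.log (μ s) / (k : EReal) ≤ (c : EReal) := by
  have hk' : (0 : EReal) < (k : EReal) := by exact_mod_cast hk
  rw [EReal.div_le_iff_le_mul hk' (EReal.natCast_ne_top k)]
  calc ENNReal.log (μ s) = ENNReal.log (ENNReal.ofReal (μ.real s)) := by
        rw [ofReal_measureReal]
    _ ≤ ENNReal.log (ENNReal.ofReal (Real.exp (k * c))) :=
        ENNReal.log_monotone (ENNReal.ofReal_le_ofReal h)
    _ = (k : EReal) * (c : EReal) := by
        rw [ENNReal.log_ofReal_of_pos (Real.exp_pos _), Real.log_exp, EReal.coe_mul]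
        rfl

theorem le_log_measure_div (hk : 0 < k) (h : Real.exp (k * c) ≤ μ.real s) :
    (c : EReal) ≤ ENNReal.log (μ s) / (k : EReal) := by
  have hk' : (0 : EReal) < (k : EReal) := by exact_mod_cast hk
  rw [EReal.le_div_iff_mul_le hk' (EReal.natCast_ne_top k)]
  calc (c : EReal) * (k : EReal) = ENNReal.log (ENNReal.ofReal (Real.exp (k * c))) := by
        rw [ENNReal.log_ofReal_of_pos (Real.exp_pos _), Real.log_exp, mul_comm (k : ℝ),
          EReal.coe_mul]
        rfl
    _ ≤ ENNReal.log (ENNReal.ofReal (μ.real s)) :=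
        ENNReal.log_monotone (ENNReal.ofReal_le_ofReal h)
    _ = ENNReal.log (μ s) := by rw [ofReal_measureReal]

end ExponentialScale

section LocalLowerBound

variable {Ω : ℕ → Type*} [∀ k, MeasurableSpace (Ω k)] {P : ∀ k, Measure (Ω k)}
  [∀ k, IsProbabilityMeasure (P k)] {Y : ∀ k, Ω k → ℝ} {x r : ℝ}

/-- The probability that `Y k` is close to `x` decays at most at the exponential rate `r`. -/
def HasLocalLowerBound (P : ∀ k, Measure (Ω k)) (Y : ∀ k, Ω k → ℝ) (x r : ℝ) : Prop :=
  ∀ ε > 0, ∀ δ > 0, ∀ᶠ k : ℕ in atTop,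
    Real.exp (-(k * (r + δ))) ≤ (P k).real {ω | |Y k ω - x| < ε}

theorem HasLocalLowerBound.of_approx
    (h : ∀ η > 0, ∃ x' r', |x' - x| < η ∧ r' < r + η ∧ HasLocalLowerBound P Y x' r') :
    HasLocalLowerBound P Y x r := by
  intro ε hε δ hδ
  obtain ⟨x', r', hx, hr, h'⟩ := h (min (ε / 2) (δ / 2)) (by positivity)
  filter_upwards [h' (ε / 2) (by positivity) (δ / 2) (by positivity)] with k hk
  have h1 := hx.trans_le (min_le_left _ _)
  have h2 := hr.trans_le (add_le_add_right (min_le_right _ _) r)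
  refine (Real.exp_le_exp.2 ?_).trans (hk.trans (measureReal_mono ?_))
  · exact neg_le_neg (mul_le_mul_of_nonneg_left (by linarith) k.cast_nonneg)
  · intro ω (hω : |Y k ω - x'| < ε / 2)
    have := abs_sub_le (Y k ω) x' x
    show |Y k ω - x| < ε
    linarith

theorem HasLocalLowerBound.neg_le_liminf (h : HasLocalLowerBound P Y x r) {U : Set ℝ}
    (hU : IsOpen U) (hx : x ∈ U) :
    -(r : EReal) ≤
      liminf (fun k : ℕ => ENNReal.log (P k {ω | Y k ω ∈ U}) / (k : EReal)) atTop := by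
  by_contra! hlt
  obtain ⟨c, hc1, hc2⟩ := EReal.lt_iff_exists_real_btwn.1 hlt
  refine hc1.not_ge ?_
  have hc : c < -r := by exact_mod_cast hc2
  obtain ⟨ε, hε, hball⟩ := Metric.isOpen_iff.1 hU x hx
  refine le_liminf_of_le (by isBoundedDefault) ?_
  filter_upwards [h ε hε (-r - c) (by linarith), eventually_gt_atTop 0] with k hk hk0
  refine le_log_measure_div hk0 ?_
  have heq : -((k : ℝ) * (r + (-r - c))) = k * c := by ring
  rw [heq] at hk
  exact hk.trans (measureReal_mono fun ω hω => hball (by rwa [Metric.mem_ball, Real.dist_eq]))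

end LocalLowerBound

/-! ### Large deviations of bounded sequences from scaled cumulant generating functions -/

section Bounded

variable {Ω : Type*} [MeasurableSpace Ω] {μ : Measure Ω} [IsProbabilityMeasure μ] {X : Ω → ℝ}
  {a b : ℝ}

theorem integrable_exp_mul_of_bounded (hX : Measurable X) (hb : ∀ ω, X ω ∈ Icc a b) (t : ℝ) :
    Integrable (fun ω => Real.exp (t * X ω)) μ :=
  integrable_exp_mul_of_mem_Icc hX.aemeasurable (Eventually.of_forall hb)

theorem exp_cgf_of_bounded (hX : Measurable X) (hb : ∀ ω, X ω ∈ Icc a b) (t : ℝ) :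
    Real.exp (cgf X μ t) = mgf X μ t :=
  exp_cgf (integrable_exp_mul_of_bounded hX hb t)

/-- The cumulant generating function is convex, by the weighted arithmetic-geometric mean
inequality for the two normalized exponentials. -/
theorem convexOn_cgf_of_bounded (hX : Measurable X) (hb : ∀ ω, X ω ∈ Icc a b) :
    ConvexOn ℝ univ (cgf X μ) := by
  refine ⟨convex_univ, fun s _ t _ u v hu hv huv => ?_⟩
  have hint := fun t => integrable_exp_mul_of_bounded (μ := μ) hX hb t
  simp only [smul_eq_mul]
  have hpt : ∀ ω, Real.exp (-(u * cgf X μ s + v * cgf X μ t)) *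
      Real.exp ((u * s + v * t) * X ω) ≤
      u * (Real.exp (-cgf X μ s) * Real.exp (s * X ω)) +
        v * (Real.exp (-cgf X μ t) * Real.exp (t * X ω)) := by
    intro ω
    have := convexOn_exp.2 (mem_univ (s * X ω - cgf X μ s)) (mem_univ (t * X ω - cgf X μ t))
      hu hv huv
    simp only [smul_eq_mul] at this
    rw [← Real.exp_add, ← Real.exp_add, ← Real.exp_add]
    refine (le_of_eq ?_).trans (this.trans (le_of_eq ?_))
    · congr 1; ring
    · congr 3 <;> ring
  have hI := integral_mono ((hint (u * s + v * t)).const_mul _)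
    ((((hint s).const_mul _).const_mul u).add (((hint t).const_mul _).const_mul v)) hpt
  simp only [Pi.add_apply] at hI
  rw [integral_add (((hint s).const_mul _).const_mul u) (((hint t).const_mul _).const_mul v)] at hI
  simp only [integral_const_mul] at hI
  change Real.exp _ * mgf X μ _ ≤ u * (Real.exp _ * mgf X μ s) + v * (Real.exp _ * mgf X μ t) at hI
  simp only [← exp_cgf_of_bounded hX hb, ← Real.exp_add] at hI
  rw [neg_add_cancel, neg_add_cancel, Real.exp_zero, mul_one, mul_one, huv,
    Real.exp_le_one_iff] at hI
  linarith

theorem monotone_cgf_of_nonneg (hX : Measurable X) (hb : ∀ ω, X ω ∈ Icc 0 b) :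
    Monotone (cgf X μ) := by
  intro s t hst
  rw [← Real.exp_le_exp, exp_cgf_of_bounded hX hb, exp_cgf_of_bounded hX hb]
  refine integral_mono (integrable_exp_mul_of_bounded hX hb s)
    (integrable_exp_mul_of_bounded hX hb t) fun ω => ?_
  exact Real.exp_le_exp.2 (mul_le_mul_of_nonneg_right hst (hb ω).1)

theorem cgf_sub_le_of_bounded (hX : Measurable X) (hb : ∀ ω, X ω ∈ Icc a b) {s t : ℝ}
    (hst : s ≤ t) : cgf X μ t ≤ cgf X μ s + (t - s) * b := by
  rw [← Real.exp_le_exp, Real.exp_add, exp_cgf_of_bounded hX hb, exp_cgf_of_bounded hX hb, mgf,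
    mgf, ← integral_mul_const]
  refine integral_mono (integrable_exp_mul_of_bounded hX hb t)
    ((integrable_exp_mul_of_bounded hX hb s).mul_const _) fun ω => ?_
  rw [← Real.exp_add, Real.exp_le_exp]
  linarith [mul_le_mul_of_nonneg_left (hb ω).2 (sub_nonneg.2 hst)]

end Bounded

section ScaledLimit

variable {Ω : ℕ → Type*} [∀ k, MeasurableSpace (Ω k)] {P : ∀ k, Measure (Ω k)}
  [∀ k, IsProbabilityMeasure (P k)] {L : ∀ k, Ω k → ℝ} {Λ : ℝ → ℝ} {M : ℝ}

theorem convexOn_of_tendsto_cgf (hL : ∀ k, Measurable (L k))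
    (hb : ∀ (k : ℕ) ω, L k ω ∈ Icc 0 (k * M))
    (hΛ : ∀ α, Tendsto (fun k : ℕ => (k : ℝ)⁻¹ * cgf (L k) (P k) α) atTop (𝓝 (Λ α))) :
    ConvexOn ℝ univ Λ := by
  refine ⟨convex_univ, fun s _ t _ u v hu hv huv => ?_⟩
  refine le_of_tendsto_of_tendsto' (hΛ _) (((hΛ s).const_mul u).add ((hΛ t).const_mul v))
    fun k => ?_
  have := mul_le_mul_of_nonneg_left
    ((convexOn_cgf_of_bounded (μ := P k) (hL k) (hb k)).2 (mem_univ s) (mem_univ t) hu hv huv)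
    (inv_nonneg.2 k.cast_nonneg : (0 : ℝ) ≤ (k : ℝ)⁻¹)
  simp only [smul_eq_mul] at this ⊢
  linarith

theorem monotone_of_tendsto_cgf (hL : ∀ k, Measurable (L k))
    (hb : ∀ (k : ℕ) ω, L k ω ∈ Icc 0 (k * M))
    (hΛ : ∀ α, Tendsto (fun k : ℕ => (k : ℝ)⁻¹ * cgf (L k) (P k) α) atTop (𝓝 (Λ α))) :
    Monotone Λ := fun _ _ hst =>
  le_of_tendsto_of_tendsto' (hΛ _) (hΛ _) fun k =>
    mul_le_mul_of_nonneg_left (monotone_cgf_of_nonneg (hL k) (hb k) hst)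
      (inv_nonneg.2 k.cast_nonneg)

theorem sub_le_of_tendsto_cgf (hL : ∀ k, Measurable (L k))
    (hb : ∀ (k : ℕ) ω, L k ω ∈ Icc 0 (k * M))
    (hΛ : ∀ α, Tendsto (fun k : ℕ => (k : ℝ)⁻¹ * cgf (L k) (P k) α) atTop (𝓝 (Λ α)))
    {s t : ℝ} (hst : s ≤ t) : Λ t ≤ Λ s + (t - s) * M := by
  refine le_of_tendsto_of_tendsto (hΛ t) ((hΛ s).add_const _) ?_
  filter_upwards [eventually_gt_atTop 0] with k hk
  have hk' : (k : ℝ) ≠ 0 := by positivity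
  have := mul_le_mul_of_nonneg_left (cgf_sub_le_of_bounded (μ := P k) (hL k) (hb k) hst)
    (inv_nonneg.2 k.cast_nonneg : (0 : ℝ) ≤ (k : ℝ)⁻¹)
  refine this.trans (le_of_eq ?_)
  field_simp

/-- Chernoff's bound: below the value of the transform at `x`, every rate is an exponential
upper bound in a neighbourhood of `x`. -/
theorem exists_nhds_measure_le (hL : ∀ k, Measurable (L k))
    (hb : ∀ (k : ℕ) ω, L k ω ∈ Icc 0 (k * M))
    (hΛ : ∀ α, Tendsto (fun k : ℕ => (k : ℝ)⁻¹ * cgf (L k) (P k) α) atTop (𝓝 (Λ α)))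
    {x c : ℝ} (hc : (c : EReal) < legendreFenchel Λ x) :
    ∃ V ∈ 𝓝 x, ∀ᶠ k : ℕ in atTop,
      (P k).real {ω | (k : ℝ)⁻¹ * L k ω ∈ V} ≤ Real.exp (-(k * c)) := by
  obtain ⟨α, hα⟩ := lt_iSup_iff.1 hc
  have hα' : c < x * α - Λ α := by exact_mod_cast hα
  obtain ⟨d, hd1, hd2⟩ := exists_between (by linarith : c + Λ α < x * α)
  refine ⟨{y | d < y * α}, (continuous_id.mul continuous_const).tendsto x |>.eventually_const_lt
    (by simpa using hd2), ?_⟩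
  filter_upwards [(hΛ α).eventually_lt_const (by linarith : Λ α < d - c),
    eventually_gt_atTop 0] with k hk hk0
  have hk' : (0 : ℝ) < k := by exact_mod_cast hk0
  have hint : Integrable (fun ω => Real.exp (1 * (α * L k ω))) (P k) := by
    simpa using integrable_exp_mul_of_bounded (hL k) (hb k) α
  have hch := measure_ge_le_exp_cgf (μ := P k) (X := fun ω => α * L k ω) (k * d) zero_le_one hint
  have hcgf : cgf (fun ω => α * L k ω) (P k) 1 = cgf (L k) (P k) α := by
    simp [cgf, mgf_const_mul]
  rw [hcgf] at hch
  refine (measureReal_mono fun ω (hω : d < (k : ℝ)⁻¹ * L k ω * α) => ?_).trans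
    (hch.trans (Real.exp_le_exp.2 ?_))
  · show k * d ≤ α * L k ω
    calc k * d ≤ k * ((k : ℝ)⁻¹ * L k ω * α) := mul_le_mul_of_nonneg_left hω.le hk'.le
      _ = α * L k ω := by field_simp
  · rw [inv_mul_lt_iff₀ hk'] at hk
    linarith

/-- The large deviation upper bound. All the variables take values in one compact interval, so
finitely many of the neighbourhoods of `exists_nhds_measure_le` cover the closed set. -/
theorem limsup_log_measure_le (hL : ∀ k, Measurable (L k))
    (hb : ∀ (k : ℕ) ω, L k ω ∈ Icc 0 (k * M))
    (hΛ : ∀ α, Tendsto (fun k : ℕ => (k : ℝ)⁻¹ * cgf (L k) (P k) α) atTop (𝓝 (Λ α)))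
    {F : Set ℝ} (hF : IsClosed F) :
    limsup (fun k : ℕ => ENNReal.log (P k {ω | (k : ℝ)⁻¹ * L k ω ∈ F}) / (k : EReal)) atTop
      ≤ -⨅ x ∈ F, legendreFenchel Λ x := by
  by_contra! hlt
  obtain ⟨c, hc1, hc2⟩ := EReal.lt_iff_exists_real_btwn.1 hlt
  obtain ⟨d, hd1, hd2⟩ := EReal.lt_iff_exists_real_btwn.1 hc1
  -- `-c < -d` are rates below the infimum: the gap absorbs the number of neighbourhoods
  have hd : ∀ x ∈ F, ((-d : ℝ) : EReal) < legendreFenchel Λ x := by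
    intro x hx
    have h1 : ((-d : ℝ) : EReal) < ⨅ x ∈ F, legendreFenchel Λ x := by
      rw [EReal.coe_neg]
      exact EReal.neg_lt_comm.1 hd1
    exact h1.trans_le (iInf₂_le x hx)
  have hcd : d < c := by exact_mod_cast hd2
  have hcover : ∃ C : ℝ, ∀ᶠ k : ℕ in atTop,
      (P k).real {ω | (k : ℝ)⁻¹ * L k ω ∈ F ∩ Icc 0 M} ≤ C * Real.exp (-(k * (-d))) := by
    refine (isCompact_Icc.inter_left hF).induction_on
      (p := fun S => ∃ C : ℝ, ∀ᶠ k : ℕ in atTop,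
        (P k).real {ω | (k : ℝ)⁻¹ * L k ω ∈ S} ≤ C * Real.exp (-(k * (-d))))
      ⟨0, by simp⟩ ?_ ?_ ?_
    · rintro s t hst ⟨C, hC⟩
      exact ⟨C, hC.mono fun k hk => (measureReal_mono (preimage_mono hst)).trans hk⟩
    · rintro s t ⟨C, hC⟩ ⟨D, hD⟩
      refine ⟨C + D, ?_⟩
      filter_upwards [hC, hD] with k h1 h2
      rw [add_mul]
      exact (measureReal_union_le {ω | (k : ℝ)⁻¹ * L k ω ∈ s} {ω | (k : ℝ)⁻¹ * L k ω ∈ t}).trans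
        (add_le_add h1 h2)
    · intro x hx
      obtain ⟨V, hV, hk⟩ := exists_nhds_measure_le hL hb hΛ (hd x hx.1)
      exact ⟨V, nhdsWithin_le_nhds hV, 1, by simpa using hk⟩
  obtain ⟨C, hC⟩ := hcover
  refine hc2.not_ge (limsup_le_of_le (by isBoundedDefault) ?_)
  have hlim : Tendsto (fun k : ℕ => (k : ℝ) * (c - d)) atTop atTop :=
    tendsto_natCast_atTop_atTop.atTop_mul_const (by linarith)
  filter_upwards [hC, eventually_gt_atTop 0,
    (Real.tendsto_exp_atTop.comp hlim).eventually_ge_atTop C] with k hk hk0 hkC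
  have hk' : (0 : ℝ) < k := by exact_mod_cast hk0
  refine log_measure_div_le hk0 ?_
  have hset : {ω | (k : ℝ)⁻¹ * L k ω ∈ F} = {ω | (k : ℝ)⁻¹ * L k ω ∈ F ∩ Icc 0 M} := by
    ext ω
    refine ⟨fun h => ⟨h, ?_, ?_⟩, fun h => h.1⟩
    · exact mul_nonneg (inv_nonneg.2 hk'.le) (hb k ω).1
    · rw [inv_mul_le_iff₀ hk']
      exact (hb k ω).2
  rw [hset]
  refine hk.trans ((mul_le_mul_of_nonneg_right hkC (Real.exp_pos _).le).trans (le_of_eq ?_))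
  simp only [Function.comp_apply, ← Real.exp_add]
  congr 1
  ring

theorem satisfiesLDP_of_hasLocalLowerBound (hL : ∀ k, Measurable (L k))
    (hb : ∀ (k : ℕ) ω, L k ω ∈ Icc 0 (k * M))
    (hΛ : ∀ α, Tendsto (fun k : ℕ => (k : ℝ)⁻¹ * cgf (L k) (P k) α) atTop (𝓝 (Λ α)))
    (hlow : ∀ x, legendreFenchel Λ x ≠ ⊤ →
      HasLocalLowerBound P (fun k ω => (k : ℝ)⁻¹ * L k ω) x (legendreFenchel Λ x).toReal) :
    SatisfiesLDP P (fun k ω => (k : ℝ)⁻¹ * L k ω) (legendreFenchel Λ) where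
  nonneg := legendreFenchel_nonneg <| le_of_eq <|
    tendsto_nhds_unique (hΛ 0) (by simp)
  lowerSemicontinuous := lowerSemicontinuous_legendreFenchel Λ
  upper_bound _ hF := limsup_log_measure_le hL hb hΛ hF
  lower_bound U hU := by
    rw [EReal.neg_le]
    refine le_iInf₂ fun x hx => ?_
    rw [EReal.neg_le]
    by_cases htop : legendreFenchel Λ x = ⊤
    · simp [htop]
    · rw [← coe_toReal_legendreFenchel htop]
      exact (hlow x htop).neg_le_liminf hU hx

theorem eventually_exp_mul_mgf_le (hL : ∀ k, Measurable (L k))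
    (hb : ∀ (k : ℕ) ω, L k ω ∈ Icc 0 (k * M))
    (hΛ : ∀ α, Tendsto (fun k : ℕ => (k : ℝ)⁻¹ * cgf (L k) (P k) α) atTop (𝓝 (Λ α)))
    {α θ c : ℝ} (h : Λ (α + θ) - θ * c < Λ α) :
    ∀ᶠ k : ℕ in atTop, Real.exp (-(θ * (k * c))) * mgf (L k) (P k) (α + θ) ≤
      1 / 4 * mgf (L k) (P k) α := by
  have h1 : Tendsto (fun k : ℕ => (k : ℝ)⁻¹ * cgf (L k) (P k) α -
      ((k : ℝ)⁻¹ * cgf (L k) (P k) (α + θ) - θ * c)) atTop (𝓝 (Λ α - (Λ (α + θ) - θ * c))) :=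
    (hΛ α).sub ((hΛ (α + θ)).sub_const _)
  have h2 := (tendsto_natCast_atTop_atTop (R := ℝ)).atTop_mul_pos (sub_pos.2 h) h1
  filter_upwards [h2.eventually_ge_atTop (Real.log 4), eventually_gt_atTop 0] with k hk hk0
  have hk' : (k : ℝ) ≠ 0 := by positivity
  rw [← exp_cgf_of_bounded (hL k) (hb k), ← exp_cgf_of_bounded (hL k) (hb k), ← Real.exp_add,
    show (1 / 4 : ℝ) = Real.exp (-Real.log 4) by
      rw [Real.exp_neg, Real.exp_log (by norm_num)]; norm_num, ← Real.exp_add, Real.exp_le_exp]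
  have heq : (k : ℝ) * ((k : ℝ)⁻¹ * cgf (L k) (P k) α -
      ((k : ℝ)⁻¹ * cgf (L k) (P k) (α + θ) - θ * c)) =
      cgf (L k) (P k) α - cgf (L k) (P k) (α + θ) + θ * (k * c) := by
    field_simp
    ring
  linarith

/-- The local large deviation lower bound at a slope of `Λ`. Under the exponentially tilted law
of parameter `α`, the variable concentrates at `x = Λ'(α)`: in `E[exp (α L)]` the contribution of
the values at distance at least `ε` from `k x` is at most half, by Chernoff's bound at two
parameters close to `α`. -/
theorem hasLocalLowerBound_of_hasDerivAt (hL : ∀ k, Measurable (L k))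
    (hb : ∀ (k : ℕ) ω, L k ω ∈ Icc 0 (k * M))
    (hΛ : ∀ α, Tendsto (fun k : ℕ => (k : ℝ)⁻¹ * cgf (L k) (P k) α) atTop (𝓝 (Λ α)))
    {x α : ℝ} (hx : HasDerivAt Λ x α) :
    HasLocalLowerBound P (fun k ω => (k : ℝ)⁻¹ * L k ω) x (x * α - Λ α) := by
  intro ε₀ hε₀ δ hδ
  obtain ⟨ε, hε, hεε₀, hεδ⟩ : ∃ ε > 0, ε ≤ ε₀ ∧ |α| * ε ≤ δ / 2 := by
    refine ⟨min ε₀ (δ / (2 * (|α| + 1))), by positivity, min_le_left _ _, ?_⟩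
    calc |α| * min ε₀ (δ / (2 * (|α| + 1))) ≤ (|α| + 1) * (δ / (2 * (|α| + 1))) := by
          gcongr
          · linarith
          · exact min_le_right _ _
      _ = δ / 2 := by field_simp
  obtain ⟨θ, hθ, hθ'⟩ : ∃ θ > 0, Λ (α + θ) - θ * (x + ε) < Λ α := by
    obtain ⟨θ, h1, h2⟩ := ((hx.tendsto_slope_zero_right.eventually_lt_const
      (by linarith : x < x + ε)).and self_mem_nhdsWithin).exists
    refine ⟨θ, h2, ?_⟩
    rw [smul_eq_mul, inv_mul_lt_iff₀ h2] at h1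
    linarith
  obtain ⟨ξ, hξ, hξ'⟩ : ∃ ξ < 0, Λ (α + ξ) - ξ * (x - ε) < Λ α := by
    obtain ⟨ξ, h1, h2⟩ := ((hx.tendsto_slope_zero_left.eventually_const_lt
      (by linarith : x - ε < x)).and self_mem_nhdsWithin).exists
    refine ⟨ξ, h2, ?_⟩
    have h3 := mul_lt_mul_of_neg_left h1 h2
    rw [smul_eq_mul, mul_inv_cancel_left₀ (ne_of_lt h2)] at h3
    linarith
  have hlog : Tendsto (fun k : ℕ => (k : ℝ) * (δ / 4)) atTop atTop :=
    tendsto_natCast_atTop_atTop.atTop_mul_const (by linarith)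
  filter_upwards [eventually_exp_mul_mgf_le hL hb hΛ hθ', eventually_exp_mul_mgf_le hL hb hΛ hξ',
    (hΛ α).eventually_const_lt (by linarith : Λ α - δ / 4 < Λ α), eventually_gt_atTop 0,
    hlog.eventually_ge_atTop (Real.log 2)] with k hk1 hk2 hk3 hk0 hk4
  have hk' : (0 : ℝ) < k := by exact_mod_cast hk0
  set A : Set (Ω k) := {ω | |(k : ℝ)⁻¹ * L k ω - x| < ε} with hA
  have hAm : MeasurableSet A := by
    have : Measurable fun ω => |(k : ℝ)⁻¹ * L k ω - x| :=
      (((hL k).const_mul _).sub_const _).norm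
    exact this measurableSet_Iio
  have hint := fun t => integrable_exp_mul_of_bounded (μ := P k) (hL k) (hb k) t
  have hpt : ∀ ω, Real.exp (α * L k ω) ≤
      A.indicator (fun _ => Real.exp (k * (α * x + |α| * ε))) ω +
        (Real.exp (-(θ * (k * (x + ε)))) * Real.exp ((α + θ) * L k ω) +
          Real.exp (-(ξ * (k * (x - ε)))) * Real.exp ((α + ξ) * L k ω)) := by
    intro ω
    have hkL : L k ω = k * ((k : ℝ)⁻¹ * L k ω) := by field_simp
    rw [← Real.exp_add, ← Real.exp_add]
    by_cases hω : ω ∈ A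
    · rw [indicator_of_mem hω]
      have h1 : α * ((k : ℝ)⁻¹ * L k ω - x) ≤ |α| * ε :=
        (le_abs_self _).trans (by rw [abs_mul]; gcongr; exact le_of_lt hω)
      have h2 := mul_le_mul_of_nonneg_left h1 hk'.le
      have h3 : Real.exp (α * L k ω) ≤ Real.exp (k * (α * x + |α| * ε)) := by
        rw [Real.exp_le_exp, hkL]
        linarith
      linarith [Real.exp_pos (-(θ * (k * (x + ε))) + (α + θ) * L k ω),
        Real.exp_pos (-(ξ * (k * (x - ε))) + (α + ξ) * L k ω)]
    · rw [indicator_of_notMem hω, zero_add]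
      rw [hA, mem_ofPred_eq, not_lt, le_abs] at hω
      rcases hω with hω | hω
      · have h1 : θ * (k * (x + ε)) ≤ θ * L k ω := by
          rw [hkL]; gcongr; linarith
        have h2 : Real.exp (α * L k ω) ≤
            Real.exp (-(θ * (k * (x + ε))) + (α + θ) * L k ω) :=
          Real.exp_le_exp.2 (by linarith)
        linarith [Real.exp_pos (-(ξ * (k * (x - ε))) + (α + ξ) * L k ω)]
      · have h0 : L k ω ≤ k * (x - ε) := by
          rw [hkL]; gcongr; linarith
        have h1 : ξ * (k * (x - ε)) ≤ ξ * L k ω := mul_le_mul_of_nonpos_left h0 hξ.le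
        have h2 : Real.exp (α * L k ω) ≤
            Real.exp (-(ξ * (k * (x - ε))) + (α + ξ) * L k ω) :=
          Real.exp_le_exp.2 (by linarith)
        linarith [Real.exp_pos (-(θ * (k * (x + ε))) + (α + θ) * L k ω)]
  have hi1 : Integrable (A.indicator fun _ => Real.exp (k * (α * x + |α| * ε))) (P k) :=
    (integrable_const _).indicator hAm
  have hi2 := (hint (α + θ)).const_mul (Real.exp (-(θ * (k * (x + ε)))))
  have hi3 := (hint (α + ξ)).const_mul (Real.exp (-(ξ * (k * (x - ε)))))
  have hi23 : Integrable (fun ω => Real.exp (-(θ * (k * (x + ε)))) * Real.exp ((α + θ) * L k ω) +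
      Real.exp (-(ξ * (k * (x - ε)))) * Real.exp ((α + ξ) * L k ω)) (P k) := hi2.add hi3
  have hI := integral_mono (hint α) (hi1.add hi23) hpt
  simp only [Pi.add_apply] at hI
  rw [integral_add hi1 hi23, integral_add hi2 hi3, integral_const_mul,
    integral_const_mul, integral_indicator_const _ hAm, smul_eq_mul] at hI
  change mgf (L k) (P k) α ≤ _ + (_ * mgf (L k) (P k) (α + θ) + _ * mgf (L k) (P k) (α + ξ)) at hI
  have hhalf : 1 / 2 * mgf (L k) (P k) α ≤
      (P k).real A * Real.exp (k * (α * x + |α| * ε)) := by linarith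
  rw [← exp_cgf_of_bounded (hL k) (hb k), show (1 / 2 : ℝ) = Real.exp (-Real.log 2) by
    rw [Real.exp_neg, Real.exp_log (by norm_num)]; norm_num, ← Real.exp_add,
    ← div_le_iff₀ (Real.exp_pos _), ← Real.exp_sub] at hhalf
  refine (Real.exp_le_exp.2 ?_).trans (hhalf.trans (measureReal_mono fun ω hω => hω.trans_le hεε₀))
  have hcgf : k * (Λ α - δ / 4) < cgf (L k) (P k) α := by
    rw [lt_inv_mul_iff₀ hk'] at hk3
    exact hk3
  have := mul_le_mul_of_nonneg_left hεδ hk'.le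
  linarith

end ScaledLimit


/-! ### Guesswork of one random word -/

namespace IsGuesswork

variable {X : Type*} [Fintype X] {p : X → ℝ} {g : X → ℕ}

theorem one_le (h : IsGuesswork p g) (x : X) : 1 ≤ g x := (h.bijOn.mapsTo (mem_univ x)).1

theorem le_card (h : IsGuesswork p g) (x : X) : g x ≤ Fintype.card X :=
  (h.bijOn.mapsTo (mem_univ x)).2

theorem injective (h : IsGuesswork p g) : Function.Injective g := injOn_univ.1 h.bijOn.injOn

theorem exists_eq (h : IsGuesswork p g) {n : ℕ} (h1 : 1 ≤ n) (h2 : n ≤ Fintype.card X) :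
    ∃ x, g x = n := by
  obtain ⟨x, -, hx⟩ := h.bijOn.surjOn ⟨h1, h2⟩
  exact ⟨x, hx⟩

theorem prob_le (h : IsGuesswork p g) {v w : X} (hvw : g v ≤ g w) : p w ≤ p v :=
  not_lt.1 fun hlt => (h.lt_of_prob_lt w v hlt).not_ge hvw

theorem log_mem_Icc (h : IsGuesswork p g) (x : X) :
    Real.log (g x) ∈ Icc 0 (Real.log (Fintype.card X)) := by
  have h1 : (1 : ℝ) ≤ g x := by exact_mod_cast h.one_le x
  exact ⟨Real.log_nonneg h1, Real.log_le_log (by linarith) (by exact_mod_cast h.le_card x)⟩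

theorem sum_prob_mul_inv_le (h : IsGuesswork p g) (hp : ∀ x, 0 ≤ p x) {x₀ : X} (hx₀ : g x₀ = 1) :
    ∑ x, p x * (g x : ℝ)⁻¹ ≤ p x₀ * (1 + Real.log (Fintype.card X)) := by
  calc ∑ x, p x * (g x : ℝ)⁻¹ ≤ ∑ x, p x₀ * (g x : ℝ)⁻¹ :=
        Finset.sum_le_sum fun x _ => mul_le_mul_of_nonneg_right
          (h.prob_le (by rw [hx₀]; exact h.one_le x)) (inv_nonneg.2 (Nat.cast_nonneg _))
    _ = p x₀ * ∑ x, (g x : ℝ)⁻¹ := by rw [Finset.mul_sum]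
    _ ≤ p x₀ * ∑ n ∈ Finset.Icc 1 (Fintype.card X), (n : ℝ)⁻¹ := by
        refine mul_le_mul_of_nonneg_left ?_ (hp x₀)
        rw [← Finset.sum_image (f := fun n : ℕ => (n : ℝ)⁻¹) (s := Finset.univ) (g := g)
          h.injective.injOn]
        refine Finset.sum_le_sum_of_subset_of_nonneg ?_ fun n _ _ => by positivity
        intro n hn
        obtain ⟨x, -, rfl⟩ := Finset.mem_image.1 hn
        exact Finset.mem_Icc.2 ⟨h.one_le x, h.le_card x⟩
    _ ≤ p x₀ * (1 + Real.log (Fintype.card X)) := by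
        refine mul_le_mul_of_nonneg_left ?_ (hp x₀)
        have := harmonic_le_one_add_log (Fintype.card X)
        rw [harmonic_eq_sum_Icc] at this
        push_cast at this
        exact this

theorem sum_prob_filter_le (h : IsGuesswork p g) (hp : ∀ x, 0 ≤ p x) {b c : ℝ} {v : X}
    (hv : (g v : ℝ) ≤ b) (hc : 0 ≤ c) :
    ∑ x with b ≤ g x ∧ (g x : ℝ) ≤ c, p x ≤ c * p v := by
  have hcard : ((Finset.univ.filter fun x => b ≤ g x ∧ (g x : ℝ) ≤ c).card : ℝ) ≤ c := by
    have h1 : (Finset.univ.filter fun x => b ≤ g x ∧ (g x : ℝ) ≤ c).card ≤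
        (Finset.Icc 1 ⌊c⌋₊).card := by
      refine Finset.card_le_card_of_injOn g (fun x hx => ?_) h.injective.injOn
      have hx' := (Finset.mem_filter.1 hx).2
      exact Finset.mem_coe.2 (Finset.mem_Icc.2 ⟨h.one_le x, Nat.le_floor hx'.2⟩)
    rw [Nat.card_Icc, Nat.add_sub_cancel] at h1
    exact (Nat.cast_le.2 h1).trans (Nat.floor_le hc)
  calc ∑ x with b ≤ g x ∧ (g x : ℝ) ≤ c, p x
      ≤ (Finset.univ.filter fun x => b ≤ g x ∧ (g x : ℝ) ≤ c).card • p v := by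
        refine Finset.sum_le_card_nsmul _ _ _ fun x hx => h.prob_le ?_
        have hx' := (Finset.mem_filter.1 hx).2
        exact_mod_cast hv.trans hx'.1
    _ ≤ c * p v := by
        rw [nsmul_eq_mul]
        exact mul_le_mul_of_nonneg_right hcard (hp v)

theorem le_sum_prob_filter (h : IsGuesswork p g) {a b q : ℝ} (ha : 0 ≤ a)
    (hb : b ≤ Fintype.card X) (hq : 0 ≤ q) (hqp : ∀ v, (g v : ℝ) < b → q ≤ p v) :
    (b - a - 1) * q ≤ ∑ x with a < g x ∧ (g x : ℝ) < b, p x := by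
  have hcard : b - a - 1 ≤ ((Finset.univ.filter fun x => a < g x ∧ (g x : ℝ) < b).card : ℝ) := by
    have h1 : Finset.Ioo ⌊a⌋₊ ⌈b⌉₊ ⊆
        (Finset.univ.filter fun x => a < g x ∧ (g x : ℝ) < b).image g := by
      intro n hn
      obtain ⟨hn1, hn2⟩ := Finset.mem_Ioo.1 hn
      have hnb := Nat.lt_ceil.1 hn2
      obtain ⟨x, rfl⟩ := h.exists_eq (by omega : 1 ≤ n) (by exact_mod_cast (hnb.le.trans hb))
      exact Finset.mem_image_of_mem g
        (Finset.mem_filter.2 ⟨Finset.mem_univ x, (Nat.floor_lt ha).1 hn1, hnb⟩)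
    have h2 := (Finset.card_le_card h1).trans Finset.card_image_le
    rw [Nat.card_Ioo] at h2
    have h3 : ⌈b⌉₊ ≤ (Finset.univ.filter fun x => a < g x ∧ (g x : ℝ) < b).card + ⌊a⌋₊ + 1 := by
      omega
    have h4 : (⌈b⌉₊ : ℝ) ≤
        (Finset.univ.filter fun x => a < g x ∧ (g x : ℝ) < b).card + ⌊a⌋₊ + 1 := by
      exact_mod_cast h3
    linarith [Nat.le_ceil b, Nat.floor_le ha]
  calc (b - a - 1) * q
      ≤ (Finset.univ.filter fun x => a < g x ∧ (g x : ℝ) < b).card • q := by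
        rw [nsmul_eq_mul]
        exact mul_le_mul_of_nonneg_right hcard hq
    _ ≤ _ := Finset.card_nsmul_le_sum _ _ _ fun x hx => hqp x (Finset.mem_filter.1 hx).2.2

end IsGuesswork

section OneWord

variable {Ω X : Type*} [MeasurableSpace Ω] {μ : Measure Ω} [IsProbabilityMeasure μ] [Fintype X]
  [MeasurableSpace X] [MeasurableSingletonClass X] {w : Ω → X} {g : X → ℕ}

theorem measureReal_setOf_eq_sum (hw : Measurable w) (q : X → Prop) [DecidablePred q] :
    μ.real {ω | q (w ω)} = ∑ x with q x, μ.real {ω | w ω = x} := by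
  have hset : {ω | q (w ω)} = ⋃ x ∈ Finset.univ.filter q, {ω | w ω = x} := by
    ext ω
    simp
  rw [hset, measureReal_biUnion_finset]
  · intro x _ y _ hxy
    exact disjoint_left.2 fun ω (h1 : w ω = x) (h2 : w ω = y) => hxy (h1.symm.trans h2)
  · exact fun x _ => hw (measurableSet_singleton x)

theorem integral_comp_eq_sum (hw : Measurable w) (f : X → ℝ) :
    ∫ ω, f (w ω) ∂μ = ∑ x, μ.real {ω | w ω = x} * f x := by
  have : IsProbabilityMeasure (μ.map w) := Measure.isProbabilityMeasure_map hw.aemeasurable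
  rw [← integral_map hw.aemeasurable (f := f) (measurable_of_finite f).aestronglyMeasurable,
    integral_fintype .of_finite]
  refine Finset.sum_congr rfl fun x _ => ?_
  rw [map_measureReal_apply hw (measurableSet_singleton x), smul_eq_mul]
  rfl

theorem measurable_log_comp (hw : Measurable w) (g : X → ℕ) :
    Measurable fun ω => Real.log (g (w ω)) :=
  (measurable_of_finite fun x => Real.log (g x)).comp hw

theorem IsGuesswork.measureReal_eq_one_le_mgf
    (hg : IsGuesswork (fun x => μ.real {ω | w ω = x}) g) (hw : Measurable w) (α : ℝ) :
    μ.real {ω | g (w ω) = 1} ≤ mgf (fun ω => Real.log (g (w ω))) μ α := by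
  have hm : MeasurableSet {ω | g (w ω) = 1} :=
    ((measurable_of_finite g).comp hw) (measurableSet_singleton 1)
  rw [← integral_indicator_one hm, mgf]
  refine integral_mono ((integrable_const (1 : ℝ)).indicator hm)
    (integrable_exp_mul_of_bounded (measurable_log_comp hw g) (fun ω => hg.log_mem_Icc (w ω)) α)
    fun ω => ?_
  refine indicator_apply_le' (fun hω => ?_) fun _ => (Real.exp_pos _).le
  have h1 : g (w ω) = 1 := hω
  simp [h1]

/-- Since the probabilities decrease along the list, the harmonic sum bounds the moments of
order at most `-1` by the largest probability, up to a factor logarithmic in the number of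
words. -/
theorem IsGuesswork.mgf_le (hg : IsGuesswork (fun x => μ.real {ω | w ω = x}) g)
    (hw : Measurable w) {α : ℝ} (hα : α ≤ -1) :
    mgf (fun ω => Real.log (g (w ω))) μ α ≤
      μ.real {ω | g (w ω) = 1} * (1 + Real.log (Fintype.card X)) := by
  obtain ⟨ω₀⟩ := μ.nonempty_of_neZero
  obtain ⟨x₀, hx₀⟩ := hg.exists_eq le_rfl (Fintype.card_pos_iff.2 ⟨w ω₀⟩)
  have hset : {ω | g (w ω) = 1} = {ω | w ω = x₀} := by
    ext ω
    exact ⟨fun h => hg.injective (Eq.trans h hx₀.symm), fun h => by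
      simpa [hx₀] using congrArg g h⟩
  rw [hset]
  refine le_trans ?_ (hg.sum_prob_mul_inv_le (fun _ => measureReal_nonneg) hx₀)
  rw [mgf, integral_comp_eq_sum (μ := μ) hw fun x => Real.exp (α * Real.log (g x))]
  refine Finset.sum_le_sum fun x _ => mul_le_mul_of_nonneg_left ?_ measureReal_nonneg
  have h1 : (0 : ℝ) < g x := by exact_mod_cast hg.one_le x
  calc Real.exp (α * Real.log (g x)) ≤ Real.exp (-Real.log (g x)) := by
        rw [Real.exp_le_exp]
        nlinarith [(hg.log_mem_Icc x).1]
    _ = (g x : ℝ)⁻¹ := by rw [Real.exp_neg, Real.exp_log h1]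

theorem IsGuesswork.measureReal_eq_one_pos
    (hg : IsGuesswork (fun x => μ.real {ω | w ω = x}) g) (hw : Measurable w) :
    0 < μ.real {ω | g (w ω) = 1} := by
  have h1 : 0 < mgf (fun ω => Real.log (g (w ω))) μ (-1) :=
    mgf_pos (integrable_exp_mul_of_bounded (measurable_log_comp hw g)
      (fun ω => hg.log_mem_Icc (w ω)) (-1))
  have h2 := h1.trans_le (hg.mgf_le hw le_rfl)
  exact pos_of_mul_pos_left h2 (by
    obtain ⟨ω₀⟩ := μ.nonempty_of_neZero
    linarith [(hg.log_mem_Icc (w ω₀)).1.trans (hg.log_mem_Icc (w ω₀)).2])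

/-- Probability to the right propagates to the left: if an interval of ranks up to `d` has
probability at least `t`, then every word of smaller rank has probability at least `t / d`. -/
theorem IsGuesswork.mul_le_measureReal
    (hg : IsGuesswork (fun x => μ.real {ω | w ω = x}) g) (hw : Measurable w) {a b c d t : ℝ}
    (ha : 0 ≤ a) (hbc : b ≤ c) (hd : 0 < d) (ht : 0 < t)
    (h : t ≤ μ.real {ω | c ≤ g (w ω) ∧ (g (w ω) : ℝ) ≤ d}) :
    (b - a - 1) * (t / d) ≤ μ.real {ω | a < g (w ω) ∧ (g (w ω) : ℝ) < b} := by
  classical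
  rw [measureReal_setOf_eq_sum hw fun x => a < g x ∧ (g x : ℝ) < b]
  have hne : {ω | c ≤ g (w ω) ∧ (g (w ω) : ℝ) ≤ d}.Nonempty := by
    by_contra hemp
    rw [not_nonempty_iff_eq_empty] at hemp
    rw [hemp, measureReal_empty] at h
    linarith
  obtain ⟨ω₁, hω₁, -⟩ := hne
  refine hg.le_sum_prob_filter ha ?_ (by positivity) fun v hv => ?_
  · exact hbc.trans (hω₁.trans (by exact_mod_cast hg.le_card _))
  · rw [measureReal_setOf_eq_sum hw fun x => c ≤ g x ∧ (g x : ℝ) ≤ d] at h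
    rw [div_le_iff₀ hd, mul_comm]
    exact h.trans (hg.sum_prob_filter_le (fun _ => measureReal_nonneg) (hv.le.trans hbc) hd.le)

end OneWord

/-! ### Guesswork of long words -/

section Words

variable {m : ℕ} {Ω : ℕ → Type*} [∀ k, MeasurableSpace (Ω k)] {P : ∀ k, Measure (Ω k)}
  {W : ∀ k, Ω k → (Fin k → Fin m)} {G : ∀ k, (Fin k → Fin m) → ℕ} {p₁ : ℝ}

theorem log_guesswork_mem_Icc (hG : ∀ k, IsGuesswork (wordProb P W k) (G k)) (k : ℕ) (ω : Ω k) :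
    Real.log (G k (W k ω)) ∈ Icc 0 (k * Real.log m) := by
  simpa using (hG k).log_mem_Icc (W k ω)

theorem tendsto_inv_mul_log_one_add_mul {M : ℝ} (hM : 0 ≤ M) :
    Tendsto (fun k : ℕ => (k : ℝ)⁻¹ * Real.log (1 + k * M)) atTop (𝓝 0) := by
  have h1 : Tendsto (fun k : ℕ => (k : ℝ)⁻¹ * Real.log (1 + M) + Real.log k / k) atTop (𝓝 0) := by
    have h2 : Tendsto (fun k : ℕ => Real.log (k : ℝ) / k) atTop (𝓝 0) :=
      Real.isLittleO_log_id_atTop.tendsto_div_nhds_zero.comp tendsto_natCast_atTop_atTop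
    simpa using (tendsto_inv_atTop_nhds_zero_nat (𝕜 := ℝ)).mul_const (Real.log (1 + M)) |>.add h2
  refine squeeze_zero' (Eventually.of_forall fun k => ?_) ?_ h1
  · have : (0 : ℝ) ≤ k * M := by positivity
    exact mul_nonneg (by positivity) (Real.log_nonneg (by linarith))
  · filter_upwards [eventually_gt_atTop 0] with k hk
    have hk1 : (1 : ℝ) ≤ k := by exact_mod_cast hk
    rw [div_eq_inv_mul, ← mul_add, ← Real.log_mul (by positivity) (by positivity)]
    refine mul_le_mul_of_nonneg_left (Real.log_le_log (by positivity) ?_) (by positivity)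
    linarith

variable [∀ k, IsProbabilityMeasure (P k)]

theorem tendsto_scaledCgf_of_le_neg_one (hW : ∀ k, Measurable (W k))
    (hG : ∀ k, IsGuesswork (wordProb P W k) (G k))
    (h₂ : Tendsto (fun k : ℕ => (k : ℝ)⁻¹ * Real.log ((P k).real {ω | G k (W k ω) = 1}))
      atTop (𝓝 p₁)) {α : ℝ} (hα : α ≤ -1) :
    Tendsto (scaledCgf P W G α) atTop (𝓝 p₁) := by
  have hm : (0 : ℝ) ≤ Real.log m := Real.log_natCast_nonneg m
  have h3 := h₂.add (tendsto_inv_mul_log_one_add_mul hm)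
  rw [add_zero] at h3
  refine tendsto_of_tendsto_of_tendsto_of_le_of_le h₂ h3 (fun k => ?_) fun k => ?_
  · exact mul_le_mul_of_nonneg_left (Real.log_le_log ((hG k).measureReal_eq_one_pos (hW k))
      ((hG k).measureReal_eq_one_le_mgf (hW k) α)) (by positivity)
  · have hpos := (hG k).measureReal_eq_one_pos (hW k)
    have h4 : (0 : ℝ) ≤ k * Real.log m := by positivity
    have h5 := (hG k).mgf_le (hW k) hα
    have h6 := hpos.trans_le ((hG k).measureReal_eq_one_le_mgf (hW k) α)
    simp only [← mul_add]
    rw [← Real.log_mul hpos.ne' (by linarith)]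
    refine mul_le_mul_of_nonneg_left (Real.log_le_log h6 (h5.trans (le_of_eq ?_))) (by positivity)
    simp

theorem hasLocalLowerBound_zero (hW : ∀ k, Measurable (W k))
    (hG : ∀ k, IsGuesswork (wordProb P W k) (G k))
    (h₂ : Tendsto (fun k : ℕ => (k : ℝ)⁻¹ * Real.log ((P k).real {ω | G k (W k ω) = 1}))
      atTop (𝓝 p₁)) :
    HasLocalLowerBound P (fun k ω => (k : ℝ)⁻¹ * Real.log (G k (W k ω))) 0 (-p₁) := by
  intro ε hε δ hδ
  filter_upwards [h₂.eventually_const_lt (by linarith : p₁ - δ < p₁), eventually_gt_atTop 0]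
    with k hk hk0
  have hk' : (0 : ℝ) < k := by exact_mod_cast hk0
  rw [lt_inv_mul_iff₀ hk', Real.lt_log_iff_exp_lt ((hG k).measureReal_eq_one_pos (hW k))] at hk
  refine le_trans (le_of_eq ?_) (hk.le.trans (measureReal_mono fun ω hω => ?_))
  · congr 1
    ring
  · have h1 : G k (W k ω) = 1 := hω
    simpa [h1] using hε

/-- Because the probabilities decrease along the list, a lower bound for the guesswork near
`exp (k y)` forces one near `exp (k x)` for every `x < y`: there are about `exp (k x)` words of
that rank, each at least as likely as an average word among the `exp (k y)` later ones. -/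
theorem HasLocalLowerBound.of_lt (hW : ∀ k, Measurable (W k))
    (hG : ∀ k, IsGuesswork (wordProb P W k) (G k)) {x y r : ℝ} (hx : 0 < x) (hxy : x < y)
    (h : HasLocalLowerBound P (fun k ω => (k : ℝ)⁻¹ * Real.log (G k (W k ω))) y r) :
    HasLocalLowerBound P (fun k ω => (k : ℝ)⁻¹ * Real.log (G k (W k ω))) x (r + y - x) := by
  intro ε₀ hε₀ δ hδ
  obtain ⟨ε, hε, h1, h2, h3⟩ : ∃ ε > 0, ε ≤ ε₀ ∧ ε ≤ δ / 2 ∧ x + ε ≤ y - ε := by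
    refine ⟨min (min ε₀ (δ / 2)) ((y - x) / 2), ?_, ?_, ?_, ?_⟩
    · have : 0 < (y - x) / 2 := by linarith
      positivity
    · exact (min_le_left _ _).trans (min_le_left _ _)
    · exact (min_le_left _ _).trans (min_le_right _ _)
    · linarith [min_le_right (min ε₀ (δ / 2)) ((y - x) / 2)]
  have hlog : Tendsto (fun k : ℕ => (k : ℝ) * ε) atTop atTop :=
    tendsto_natCast_atTop_atTop.atTop_mul_const hε
  filter_upwards [h ε hε (δ / 2) (by positivity), eventually_gt_atTop 0,
    hlog.eventually_ge_atTop (Real.log 3)] with k hk hk0 hk3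
  have hk' : (0 : ℝ) < k := by exact_mod_cast hk0
  have hGpos : ∀ ω, (0 : ℝ) < G k (W k ω) := fun ω => by exact_mod_cast (hG k).one_le (W k ω)
  have hright : {ω | |(k : ℝ)⁻¹ * Real.log (G k (W k ω)) - y| < ε} ⊆
      {ω | Real.exp (k * (y - ε)) ≤ G k (W k ω) ∧
        (G k (W k ω) : ℝ) ≤ Real.exp (k * (y + ε))} := by
    intro ω (hω : |_| < ε)
    rw [abs_lt] at hω
    refine ⟨?_, ?_⟩
    · rw [← Real.le_log_iff_exp_le (hGpos ω), ← le_inv_mul_iff₀ hk']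
      linarith
    · rw [← Real.log_le_iff_le_exp (hGpos ω), ← inv_mul_le_iff₀ hk']
      linarith
  have hleft : {ω | Real.exp (k * (x - ε)) < G k (W k ω) ∧
        (G k (W k ω) : ℝ) < Real.exp (k * (x + ε))} ⊆
      {ω | |(k : ℝ)⁻¹ * Real.log (G k (W k ω)) - x| < ε₀} := by
    rintro ω ⟨h4, h5⟩
    rw [← Real.lt_log_iff_exp_lt (hGpos ω), ← lt_inv_mul_iff₀ hk'] at h4
    rw [← Real.log_lt_iff_lt_exp (hGpos ω), ← inv_mul_lt_iff₀ hk'] at h5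
    show |_| < ε₀
    rw [abs_lt]
    constructor <;> linarith
  have hmain := (hG k).mul_le_measureReal (hW k) (Real.exp_pos (k * (x - ε))).le
    (Real.exp_le_exp.2 (mul_le_mul_of_nonneg_left h3 hk'.le)) (Real.exp_pos (k * (y + ε)))
    (Real.exp_pos _) (hk.trans (measureReal_mono hright))
  refine le_trans ?_ (hmain.trans (measureReal_mono hleft))
  -- the ranks between `exp (k (x - ε))` and `exp (k (x + ε))` number at least `exp (k x)`
  have hcount : Real.exp (k * x) ≤ Real.exp (k * (x + ε)) - Real.exp (k * (x - ε)) - 1 := by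
    have h4 : 3 * Real.exp (k * x) ≤ Real.exp (k * (x + ε)) := by
      rw [← Real.exp_log (by norm_num : (0 : ℝ) < 3), ← Real.exp_add, Real.exp_le_exp]
      linarith
    have h5 : Real.exp (k * (x - ε)) ≤ Real.exp (k * x) :=
      Real.exp_le_exp.2 (mul_le_mul_of_nonneg_left (by linarith) hk'.le)
    have h6 : 1 ≤ Real.exp (k * x) := Real.one_le_exp (by positivity)
    linarith
  refine le_trans ?_ (mul_le_mul_of_nonneg_right hcount (by positivity))
  rw [← Real.exp_sub, ← Real.exp_add, Real.exp_le_exp]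
  have := mul_le_mul_of_nonneg_left h2 hk'.le
  linarith

end Words


/-! ### Convex functions that are constant up to `-1` and differentiable beyond -/

section ConvexProfile

variable {Λ : ℝ → ℝ} {p₁ γ x α : ℝ}

theorem add_deriv_mul_le (hconv : ConvexOn ℝ univ Λ) (hd : DifferentiableAt ℝ Λ α) (β : ℝ) :
    Λ α + deriv Λ α * (β - α) ≤ Λ β := by
  rcases lt_trichotomy α β with h | rfl | h
  · have := hconv.deriv_le_slope (mem_univ α) (mem_univ β) h hd
    rw [slope_def_field, le_div_iff₀ (sub_pos.2 h)] at this
    linarith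
  · simp
  · have := hconv.slope_le_deriv (mem_univ β) (mem_univ α) h hd
    rw [slope_def_field, div_le_iff₀ (sub_pos.2 h)] at this
    linarith

theorem legendreFenchel_deriv (hconv : ConvexOn ℝ univ Λ) (hd : DifferentiableAt ℝ Λ α) :
    legendreFenchel Λ (deriv Λ α) = ((deriv Λ α * α - Λ α : ℝ) : EReal) :=
  legendreFenchel_eq_of_support (add_deriv_mul_le hconv hd)

theorem legendreFenchel_eq_top_of_neg (hleft : ∀ α ≤ -1, Λ α = p₁) (hx : x < 0) :
    legendreFenchel Λ x = ⊤ := by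
  refine legendreFenchel_eq_top_of_unbounded fun r => ?_
  refine ⟨min (-1) ((r + p₁ + 1) / x), ?_⟩
  rw [hleft _ (min_le_left _ _)]
  have h1 := mul_le_mul_of_nonpos_left (min_le_right (-1) ((r + p₁ + 1) / x)) hx.le
  rw [mul_div_cancel₀ _ hx.ne] at h1
  linarith

theorem legendreFenchel_eq_top_of_deriv_le (hconv : ConvexOn ℝ univ Λ)
    (hd : ∀ α, -1 < α → DifferentiableAt ℝ Λ α) {b : ℝ} (hb : ∀ α, -1 < α → deriv Λ α ≤ b)
    (hx : b < x) : legendreFenchel Λ x = ⊤ := by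
  refine legendreFenchel_eq_top_of_unbounded fun r => ?_
  have hxb : 0 < x - b := sub_pos.2 hx
  refine ⟨max 0 ((r + Λ 0 + 1) / (x - b)), ?_⟩
  set α := max 0 ((r + Λ 0 + 1) / (x - b)) with hα
  have hα0 : 0 ≤ α := le_max_left _ _
  have h1 := add_deriv_mul_le hconv (hd α (by linarith)) 0
  have h2 := mul_le_mul_of_nonneg_right (hb α (by linarith)) hα0
  have h3 : r + Λ 0 + 1 ≤ α * (x - b) := by
    rw [← div_le_iff₀ hxb]
    exact le_max_right _ _
  linarith

theorem monotoneOn_deriv_Ioi (hconv : ConvexOn ℝ univ Λ)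
    (hd : ∀ α, -1 < α → DifferentiableAt ℝ Λ α) : MonotoneOn (deriv Λ) (Ioi (-1)) :=
  (hconv.subset (subset_univ _) (convex_Ioi _)).monotoneOn_deriv hd

/-- The right limit of the derivative at `-1` is the infimum of the derivative on `(-1, ∞)`. -/
theorem exists_tendsto_deriv (hconv : ConvexOn ℝ univ Λ)
    (hd : ∀ α, -1 < α → DifferentiableAt ℝ Λ α) (hmono : Monotone Λ) :
    ∃ γ, Tendsto (deriv Λ) (𝓝[>] (-1)) (𝓝 γ) ∧ 0 ≤ γ ∧ ∀ α, -1 < α → γ ≤ deriv Λ α := by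
  have hbdd : BddBelow (deriv Λ '' Ioi (-1)) :=
    ⟨0, by rintro _ ⟨α, -, rfl⟩; exact hmono.deriv_nonneg⟩
  exact ⟨sInf (deriv Λ '' Ioi (-1)), (monotoneOn_deriv_Ioi hconv hd).tendsto_nhdsGT hbdd,
    le_csInf (nonempty_Ioi.image _) (by rintro _ ⟨α, -, rfl⟩; exact hmono.deriv_nonneg),
    fun α hα => csInf_le hbdd (mem_image_of_mem _ hα)⟩

theorem continuous_of_convexOn (hconv : ConvexOn ℝ univ Λ) : Continuous Λ :=
  continuousOn_univ.1 (hconv.continuousOn isOpen_univ)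

theorem legendreFenchel_eq_neg_sub (hconv : ConvexOn ℝ univ Λ) (hleft : ∀ α ≤ -1, Λ α = p₁)
    (hd : ∀ α, -1 < α → DifferentiableAt ℝ Λ α) (hγ : ∀ α, -1 < α → γ ≤ deriv Λ α)
    (hx : x ∈ Icc 0 γ) : legendreFenchel Λ x = ((-x - p₁ : ℝ) : EReal) := by
  have hΛ1 : Λ (-1) = p₁ := hleft _ le_rfl
  have hsupp : ∀ β, Λ (-1) + x * (β - -1) ≤ Λ β := by
    intro β
    rcases le_or_gt β (-1) with hβ | hβ
    · rw [hΛ1, hleft β hβ]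
      linarith [mul_nonneg hx.1 (by linarith : 0 ≤ -1 - β)]
    · -- the supporting line at `α > -1` has slope at least `x`; let `α` decrease to `-1`
      have hlim : Tendsto (fun α => Λ α + x * (β - α)) (𝓝[>] (-1)) (𝓝 (Λ (-1) + x * (β - -1))) := by
        have hc := continuous_of_convexOn hconv
        have : Continuous fun α => Λ α + x * (β - α) := by fun_prop
        exact (this.tendsto (-1)).mono_left nhdsWithin_le_nhds
      refine le_of_tendsto hlim ?_
      filter_upwards [self_mem_nhdsWithin, nhdsWithin_le_nhds (eventually_lt_nhds hβ)]
        with α hα hαβ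
      have h1 := mul_le_mul_of_nonneg_right (hx.2.trans (hγ α hα)) (sub_nonneg.2 hαβ.le)
      linarith [add_deriv_mul_le hconv (hd α hα) β]
  rw [legendreFenchel_eq_of_support hsupp, hΛ1]
  congr 1
  ring

/-- A point to the right of `γ` is a slope of `Λ`, or larger than every slope. -/
theorem exists_deriv_eq_or_forall_deriv_lt (hcont : ContinuousOn (deriv Λ) (Ioi (-1)))
    (hlim : Tendsto (deriv Λ) (𝓝[>] (-1)) (𝓝 γ)) (hx : γ < x) :
    (∃ α, -1 < α ∧ deriv Λ α = x) ∨ ∀ α, -1 < α → deriv Λ α < x := by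
  by_contra! h
  obtain ⟨h1, β, hβ, hβx⟩ := h
  obtain ⟨α, hαx, hα⟩ := ((hlim.eventually_lt_const hx).and self_mem_nhdsWithin).exists
  obtain ⟨c, hc, hcx⟩ := isPreconnected_Ioi.intermediate_value hα hβ hcont ⟨hαx.le, hβx⟩
  exact h1 c hc hcx

/-- A point strictly between two points of the domain is a slope `Λ'(c)` with a unique supporting
parameter, and the supporting line of parameter `c` lies strictly below the transform at every
point other than `Λ'(c)`. -/
theorem strictConvexOn_legendreFenchel (hconv : ConvexOn ℝ univ Λ)
    (hd : ∀ α, -1 < α → DifferentiableAt ℝ Λ α) (hcont : ContinuousOn (deriv Λ) (Ioi (-1)))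
    (hlim : Tendsto (deriv Λ) (𝓝[>] (-1)) (𝓝 γ)) :
    StrictConvexOn ℝ {x | γ ≤ x ∧ legendreFenchel Λ x ≠ ⊤}
      (fun x => (legendreFenchel Λ x).toReal) := by
  have hlt : ∀ {x y : ℝ}, x ∈ {x | γ ≤ x ∧ legendreFenchel Λ x ≠ ⊤} →
      y ∈ {x | γ ≤ x ∧ legendreFenchel Λ x ≠ ⊤} → x ≠ y → ∀ {a b : ℝ}, 0 < a → 0 < b →
      a + b = 1 → (legendreFenchel Λ (a * x + b * y)).toReal <
        a * (legendreFenchel Λ x).toReal + b * (legendreFenchel Λ y).toReal := by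
    intro x y hx hy hxy a b ha hb hab
    have hγz : γ < a * x + b * y := by
      rcases hxy.lt_or_gt with h | h
      · have := mul_lt_mul_of_pos_left h hb
        have h2 : a * x + b * x = x := by rw [← add_mul, hab, one_mul]
        linarith [hx.1]
      · have := mul_lt_mul_of_pos_left h ha
        have h2 : a * y + b * y = y := by rw [← add_mul, hab, one_mul]
        linarith [hy.1]
    have hzmax : a * x + b * y < max x y := by
      have h2 : a * max x y + b * max x y = max x y := by rw [← add_mul, hab, one_mul]
      rcases hxy.lt_or_gt with h | h
      · rw [max_eq_right h.le] at h2 ⊢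
        linarith [mul_lt_mul_of_pos_left h ha]
      · rw [max_eq_left h.le] at h2 ⊢
        linarith [mul_lt_mul_of_pos_left h hb]
    rcases exists_deriv_eq_or_forall_deriv_lt hcont hlim hγz with ⟨c, hc, hcz⟩ | hall
    · have hstrict : ∀ u ≠ deriv Λ c, legendreFenchel Λ u ≠ ⊤ →
          u * c - Λ c < (legendreFenchel Λ u).toReal := by
        intro u hu hutop
        have := lt_legendreFenchel_of_hasDerivAt (hd c hc).hasDerivAt hu
        rw [← coe_toReal_legendreFenchel hutop] at this
        exact_mod_cast this
      have hxz : x ≠ deriv Λ c := by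
        rw [hcz]
        intro h
        have h2 : x = a * x + b * x := by rw [← add_mul, hab, one_mul]
        exact hxy (mul_left_cancel₀ hb.ne' (by linarith))
      have hyz : y ≠ deriv Λ c := by
        rw [hcz]
        intro h
        have h2 : y = a * y + b * y := by rw [← add_mul, hab, one_mul]
        exact hxy (mul_left_cancel₀ ha.ne' (by linarith))
      have h1 := mul_lt_mul_of_pos_left (hstrict x hxz hx.2) ha
      have h2 := mul_lt_mul_of_pos_left (hstrict y hyz hy.2) hb
      have h3 : a * Λ c + b * Λ c = Λ c := by rw [← add_mul, hab, one_mul]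
      rw [← hcz, legendreFenchel_deriv hconv (hd c hc), EReal.toReal_coe, hcz]
      linarith
    · exfalso
      have htop := legendreFenchel_eq_top_of_deriv_le hconv hd (fun α hα => (hall α hα).le) hzmax
      rcases max_choice x y with h | h
      · exact hx.2 (h ▸ htop)
      · exact hy.2 (h ▸ htop)
  refine ⟨?_, fun x hx y hy hxy a b ha hb hab => hlt hx hy hxy ha hb hab⟩
  exact (convex_Ici γ).inter (convex_setOf_legendreFenchel_ne_top Λ)

end ConvexProfile

/-! ### The large deviation principle for guesswork -/

section Words

variable {m : ℕ} {Ω : ℕ → Type*} [∀ k, MeasurableSpace (Ω k)] {P : ∀ k, Measure (Ω k)}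
  [∀ k, IsProbabilityMeasure (P k)] {W : ∀ k, Ω k → (Fin k → Fin m)}
  {G : ∀ k, (Fin k → Fin m) → ℕ} {Λ : ℝ → ℝ} {p₁ γ : ℝ}

/-- On the linear part of the rate function, where the transform is not strictly convex, the lower
bound comes from the monotonicity of the probabilities: it is transferred from slopes `Λ'(α)` with
`α` close to `-1`, for which `Λ'(α) (α + 1) - Λ(α)` is close to `-p₁`. -/
theorem hasLocalLowerBound_of_mem_Icc (hW : ∀ k, Measurable (W k))
    (hG : ∀ k, IsGuesswork (wordProb P W k) (G k))
    (h₂ : Tendsto (fun k : ℕ => (k : ℝ)⁻¹ * Real.log ((P k).real {ω | G k (W k ω) = 1}))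
      atTop (𝓝 p₁))
    (hΛ : ∀ α, Tendsto (scaledCgf P W G α) atTop (𝓝 (Λ α)))
    (hd : ∀ α, -1 < α → DifferentiableAt ℝ Λ α) (hcont : Continuous Λ) (hp₁ : Λ (-1) = p₁)
    (hlim : Tendsto (deriv Λ) (𝓝[>] (-1)) (𝓝 γ)) (hγ : ∀ α, -1 < α → γ ≤ deriv Λ α)
    {x : ℝ} (hx : x ∈ Icc 0 γ) :
    HasLocalLowerBound P (fun k ω => (k : ℝ)⁻¹ * Real.log (G k (W k ω))) x (-x - p₁) := by
  rcases hx.1.eq_or_lt with rfl | hx0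
  · simpa using hasLocalLowerBound_zero hW hG h₂
  refine HasLocalLowerBound.of_approx fun η hη => ?_
  have hslope : Tendsto (fun α => deriv Λ α * (α + 1) - Λ α) (𝓝[>] (-1)) (𝓝 (-p₁)) := by
    have h1 : Tendsto (fun α : ℝ => α + 1) (𝓝[>] (-1)) (𝓝 (-1 + 1)) :=
      ((continuous_id.add continuous_const).tendsto (-1)).mono_left nhdsWithin_le_nhds
    have h2 := (hlim.mul h1).sub ((hcont.tendsto (-1)).mono_left nhdsWithin_le_nhds)
    simpa [hp₁] using h2
  obtain ⟨α, hα, hα1⟩ := ((hslope.eventually_lt_const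
    (by linarith : -p₁ < -p₁ + η / 2)).and self_mem_nhdsWithin).exists
  -- a point slightly to the left of `x`, hence strictly to the left of the slope at `α`
  obtain ⟨x', hx'1, hx'2⟩ := exists_between (max_lt hx0 (by linarith : x - η / 2 < x))
  obtain ⟨hx'0, hx'η⟩ := max_lt_iff.1 hx'1
  refine ⟨x', _, ?_, ?_, HasLocalLowerBound.of_lt hW hG hx'0
    (hx'2.trans_le (hx.2.trans (hγ α hα1)))
    (hasLocalLowerBound_of_hasDerivAt (fun k => measurable_log_comp (hW k) (G k))
      (log_guesswork_mem_Icc hG) hΛ (hd α hα1).hasDerivAt)⟩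
  · rw [abs_lt]
    constructor <;> linarith
  · linarith

/-- Beyond `γ` the effective domain of the transform consists of slopes of `Λ`, and possibly of
their supremum, which is a limit of slopes at which the transform is not larger. -/
theorem hasLocalLowerBound_of_gt (hW : ∀ k, Measurable (W k))
    (hG : ∀ k, IsGuesswork (wordProb P W k) (G k))
    (hΛ : ∀ α, Tendsto (scaledCgf P W G α) atTop (𝓝 (Λ α))) (hconv : ConvexOn ℝ univ Λ)
    (hd : ∀ α, -1 < α → DifferentiableAt ℝ Λ α) (hcont : ContinuousOn (deriv Λ) (Ioi (-1)))
    (hlim : Tendsto (deriv Λ) (𝓝[>] (-1)) (𝓝 γ)) {x : ℝ} (hx : γ < x)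
    (htop : legendreFenchel Λ x ≠ ⊤) :
    HasLocalLowerBound P (fun k ω => (k : ℝ)⁻¹ * Real.log (G k (W k ω))) x
      (legendreFenchel Λ x).toReal := by
  have hlow : ∀ α, -1 < α → HasLocalLowerBound P
      (fun k ω => (k : ℝ)⁻¹ * Real.log (G k (W k ω))) (deriv Λ α) (deriv Λ α * α - Λ α) :=
    fun α hα => hasLocalLowerBound_of_hasDerivAt (fun k => measurable_log_comp (hW k) (G k))
      (log_guesswork_mem_Icc hG) hΛ (hd α hα).hasDerivAt
  rcases exists_deriv_eq_or_forall_deriv_lt hcont hlim hx with ⟨α, hα, rfl⟩ | hall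
  · rw [legendreFenchel_deriv hconv (hd α hα), EReal.toReal_coe]
    exact hlow α hα
  refine HasLocalLowerBound.of_approx fun η hη => ?_
  obtain ⟨β, hβ, hβx⟩ : ∃ β, -1 < β ∧ x - η < deriv Λ β := by
    by_contra! h
    exact htop (legendreFenchel_eq_top_of_deriv_le hconv hd h (by linarith))
  have hβ' : -1 < max β 0 := hβ.trans_le (le_max_left _ _)
  have hle : deriv Λ β ≤ deriv Λ (max β 0) :=
    monotoneOn_deriv_Ioi hconv hd hβ hβ' (le_max_left _ _)
  have hlt := hall _ hβ'
  refine ⟨deriv Λ (max β 0), _, ?_, ?_, hlow _ hβ'⟩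
  · rw [abs_lt]
    constructor <;> linarith
  · have h1 := mul_le_mul_of_nonneg_right hlt.le (le_max_right β 0)
    linarith [mul_sub_le_toReal_legendreFenchel htop (max β 0)]

end Words
end Guesswork

theorem theorem1 {m : ℕ} {Ω : ℕ → Type*} [∀ k, MeasurableSpace (Ω k)]
    (P : ∀ k, Measure (Ω k)) [∀ k, IsProbabilityMeasure (P k)]
    (W : ∀ k, Ω k → (Fin k → Fin m)) (hW : ∀ k, Measurable (W k))
    (G : ∀ k, (Fin k → Fin m) → ℕ)
    (hG : ∀ k, Guesswork.IsGuesswork (Guesswork.wordProb P W k) (G k))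
    (h₁ : Guesswork.RegularSCGF P W G)
    (p₁ : ℝ)
    (h₂ : Tendsto (fun k : ℕ => (k : ℝ)⁻¹ * Real.log ((P k).real {ω | G k (W k ω) = 1}))
      atTop (𝓝 p₁)) :
    -- the limit defining the scaled cumulant generating function exists at every real `α`
    (∀ α : ℝ, Tendsto (Guesswork.scaledCgf P W G α) atTop (𝓝 (Guesswork.sCGF P W G α))) ∧
    -- the large deviation principle
    Guesswork.SatisfiesLDP P (fun k ω => (k : ℝ)⁻¹ * Real.log (G k (W k ω)))
      (Guesswork.legendreFenchel (Guesswork.sCGF P W G)) ∧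
    -- the form of the rate function
    ContinuousOn (Guesswork.legendreFenchel (Guesswork.sCGF P W G))
      {x | Guesswork.legendreFenchel (Guesswork.sCGF P W G) x ≠ ⊤} ∧
    ∃ γ : ℝ, Tendsto (deriv (Guesswork.sCGF P W G)) (𝓝[>] (-1)) (𝓝 γ) ∧
      0 ≤ γ ∧ γ ≤ Real.log m ∧
      (∀ x ∈ Set.Icc 0 γ,
        Guesswork.legendreFenchel (Guesswork.sCGF P W G) x = ((-x - p₁ : ℝ) : EReal)) ∧
      StrictConvexOn ℝ
        {x | γ ≤ x ∧ Guesswork.legendreFenchel (Guesswork.sCGF P W G) x ≠ ⊤}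
        (fun x => (Guesswork.legendreFenchel (Guesswork.sCGF P W G) x).toReal) := by
  set Λ := Guesswork.sCGF P W G
  have hL := fun k => Guesswork.measurable_log_comp (hW k) (G k)
  have hb := Guesswork.log_guesswork_mem_Icc hG
  have hleft : ∀ α ≤ -1, Λ α = p₁ := fun α hα =>
    (Guesswork.tendsto_scaledCgf_of_le_neg_one hW hG h₂ hα).limUnder_eq
  have hlimΛ : ∀ α, Tendsto (Guesswork.scaledCgf P W G α) atTop (𝓝 (Λ α)) := by
    intro α
    rcases le_or_gt α (-1) with hα | hα
    · rw [hleft α hα]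
      exact Guesswork.tendsto_scaledCgf_of_le_neg_one hW hG h₂ hα
    · exact h₁.tendsto α hα
  have hconv := Guesswork.convexOn_of_tendsto_cgf hL hb hlimΛ
  have hmono := Guesswork.monotone_of_tendsto_cgf hL hb hlimΛ
  have hd : ∀ α, -1 < α → DifferentiableAt ℝ Λ α := fun α hα =>
    (h₁.contDiffOn.contDiffAt (isOpen_Ioi.mem_nhds hα)).differentiableAt one_ne_zero
  have hcont : ContinuousOn (deriv Λ) (Ioi (-1)) :=
    h₁.contDiffOn.continuousOn_deriv_of_isOpen isOpen_Ioi le_rfl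
  obtain ⟨γ, hγlim, hγ0, hγ⟩ := Guesswork.exists_tendsto_deriv hconv hd hmono
  have hγm : γ ≤ Real.log m := by
    have h1 := Guesswork.add_deriv_mul_le hconv (hd 0 (by norm_num)) 1
    have h2 := Guesswork.sub_le_of_tendsto_cgf hL hb hlimΛ zero_le_one
    linarith [hγ 0 (by norm_num)]
  have hlin : ∀ x ∈ Icc 0 γ, Guesswork.legendreFenchel Λ x = ((-x - p₁ : ℝ) : EReal) :=
    fun x hx => Guesswork.legendreFenchel_eq_neg_sub hconv hleft hd hγ hx
  refine ⟨hlimΛ, Guesswork.satisfiesLDP_of_hasLocalLowerBound hL hb hlimΛ fun x hx => ?_,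
    Guesswork.continuousOn_legendreFenchel Λ, γ, hγlim, hγ0, hγm, hlin,
    Guesswork.strictConvexOn_legendreFenchel hconv hd hcont hγlim⟩
  rcases lt_or_ge γ x with hγx | hxγ
  · exact Guesswork.hasLocalLowerBound_of_gt hW hG hlimΛ hconv hd hcont hγlim hγx hx
  · have hx0 : 0 ≤ x := not_lt.1 fun h => hx (Guesswork.legendreFenchel_eq_top_of_neg hleft h)
    rw [hlin x ⟨hx0, hxγ⟩, EReal.toReal_coe]
    exact Guesswork.hasLocalLowerBound_of_mem_Icc hW hG h₂ hlimΛ hd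
      (Guesswork.continuous_of_convexOn hconv) (hleft _ le_rfl) hγlim hγ ⟨hx0, hxγ⟩
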